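/- Let $(\mathcal C,J)$ be an essentially small site, let $a:[\mathcal C^{\mathrm{op}},\mathbf{Set}]\to \mathrm{Sh}(\mathcal C,J)$ be the associated sheaf functor, with $i$ the inclusion and $\eta_P:P\to a(P)$ the unit, and let $f:P\to Q$ be a morphism of presheaves on $\mathcal C$. Notation. For a presheaf $P$, the category of elements $\int P$ has as objects the pairs $(X,x)$ with $x\in P(X)$ and as morphisms $(Y,y)\to(X,x)$ the arrows $g:Y\to X$ with $P(g)(x)=y$; $\pi_P:\int P\to\mathcal C$ is the projection, and $J_P$ is the Grothendieck topology on $\int P$ whose covering sieves are precisely those sent by $\pi_P$ to $J$-covering sieves, with inclusion $i_{J_P}:\mathrm{Sh}(\int P,J_P)\to[(\int P)^{\mathrm{op}},\mathbf{Set}]$. The functor $R_P:[\mathcal C^{\mathrm{op}},\mathbf{Set}]/P\to[(\int P)^{\mathrm{op}},\mathbf{Set}]$ is given by $R_P[h](X,p)=h_X^{-1}(p)$, and $L_P:[(\int P)^{\mathrm{op}},\mathbf{Set}]\to[\mathcal C^{\mathrm{op}},\mathbf{Set}]/P$ by $L_P(W)(X)=\bigsqcup_{p\in P(X)}W(X,p)$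 with its projection to $P(X)$. Let $i_P:\mathrm{Sh}(\mathcal C,J)/a(P)\to[\mathcal C^{\mathrm{op}},\mathbf{Set}]/P$ send $[w]$ to the pullback of $i(w)$ along $\eta_P$, and let $a_P:[h]\mapsto[a(h)]$. Let $R_P^J:\mathrm{Sh}(\mathcal C,J)/a(P)\to\mathrm{Sh}(\int P,J_P)$ be the functor acting as $R_P\circ i_P$, and let $L_P^J=a_P\circ L_P\circ i_{J_P}$. The functor $\int f:\int P\to\int Q$, $(X,p)\mapsto(X,f_X(p))$, is a comorphism of sites $(\int P,J_P)\to(\int Q,J_Q)$. Let $C(\int f):\mathrm{Sh}(\int P,J_P)\to\mathrm{Sh}(\int Q,J_Q)$ be the geometric morphism it induces: its direct image $C(\int f)_*$ is the restriction to sheaves of the right Kan extension along $(\int f)^{\mathrm{op}}$, and its inverse image is the associated sheaf of the restriction along $(\int f)^{\mathrm{op}}$. Theorem. The functors $R_P^J$ and $L_P^J$ are mutually pseudo-inverse equivalences between $\mathrm{Sh}(\mathcal C,J)/a(P)$ and $\mathrm{Sh}(\int P,J_P)$, and likewise $R_Q^J$ and $L_Q^J$ for $Q$. The pullback functor $a(f)^*:\mathrm{Sh}(\mathcal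 C,J)/a(Q)\to\mathrm{Sh}(\mathcal C,J)/a(P)$ has a right adjoint (the dependent product $\prod_{a(f)}$), and under the above equivalences it corresponds to $C(\int f)_*$: for every right adjoint $\prod_{a(f)}$ of $a(f)^*$ there are natural isomorphisms $$C(\textstyle\int f)_*\circ R_P^J\;\cong\;R_Q^J\circ\prod_{a(f)},\qquad L_Q^J\circ C(\textstyle\int f)_*\;\cong\;\prod_{a(f)}\circ L_P^J .$$ -/

import Mathlib

open CategoryTheory Opposite Limits

universe w v u v₁ v₂ u₁ u₂

noncomputable section

namespace DepProd

/-- On an essentially small site, presheaves of sets have associated sheaves. -/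
instance hasSheafify_type {C : Type u} [Category.{v} C] [EssentiallySmall.{w} C]
    (J : GrothendieckTopology C) : HasSheafify J (Type w) :=
  have (K : GrothendieckTopology (SmallModel.{w} C)) : HasSheafify K (Type w) := inferInstance
  hasSheafifyEssentiallySmallSite (C := C) J (Type w)

section Geometric

/-- A geometric morphism `E → F`: a direct image functor `E ⥤ F` together with a left adjoint
(the inverse image) that preserves finite limits. -/
structure GeometricMorphism (E : Type u₁) [Category.{v₁} E] (F : Type u₂) [Category.{v₂} F] where
  /-- the direct image functor -/
  direct : E ⥤ F
  /-- the inverse image functor -/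
  inverse : F ⥤ E
  /-- the inverse image is left adjoint to the direct image -/
  adj : inverse ⊣ direct
  /-- the inverse image is left exact -/
  leftExact : PreservesFiniteLimits inverse

variable {C : Type u₁} [Category.{v₁} C] [EssentiallySmall.{w} C]
  {D : Type u₂} [Category.{v₂} D] [EssentiallySmall.{w} D]

/-- Right Kan extensions of set-valued presheaves along functors between essentially small
categories exist and are pointwise. -/
instance hasPointwiseRan (F : C ⥤ D) (W : Cᵒᵖ ⥤ Type w) :
    F.op.HasPointwiseRightKanExtension W := fun Y =>
  have := hasLimitsOfShape_of_essentiallySmall.{w} (StructuredArrow Y F.op) (Type w)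
  inferInstanceAs (HasLimit (StructuredArrow.proj Y F.op ⋙ W))

/-- The geometric morphism `C(F) : Sh(C, J) → Sh(D, K)` induced by a comorphism of sites
`F : (C, J) → (D, K)` (a functor with the covering-lifting property).
Its direct image is the restriction to sheaves of the right Kan extension along `Fᵒᵖ`, and its
inverse image is `a_J ∘ (- ∘ Fᵒᵖ) ∘ i_K`. -/
def comorphismGeometric (J : GrothendieckTopology C) (K : GrothendieckTopology D)
    (F : C ⥤ D) [F.IsCocontinuous J K] :
    GeometricMorphism (Sheaf J (Type w)) (Sheaf K (Type w)) where
  direct := F.sheafPushforwardCocontinuous (Type w) J K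
  inverse := sheafToPresheaf K (Type w) ⋙ (Functor.whiskeringLeft _ _ (Type w)).obj F.op ⋙
    presheafToSheaf J (Type w)
  adj := ((F.op.ranAdjunction (Type w)).comp
      (sheafificationAdjunction J (Type w))).restrictFullyFaithful
    (fullyFaithfulSheafToPresheaf K (Type w)) (Functor.FullyFaithful.id _)
    (Iso.refl _) (Iso.refl _)
  leftExact := by
    have h₁ : PreservesFiniteLimits (sheafToPresheaf K (Type w)) :=
      have := (sheafificationAdjunction K (Type w)).rightAdjoint_preservesLimits
      PreservesLimitsOfSize.preservesFiniteLimits.{0, 0} _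
    have h₂ : PreservesFiniteLimits ((Functor.whiskeringLeft Cᵒᵖ Dᵒᵖ (Type w)).obj F.op) :=
      ⟨fun _ => inferInstance⟩
    have h₃ : PreservesFiniteLimits (presheafToSheaf J (Type w)) := inferInstance
    exact comp_preservesFiniteLimits _ (_ ⋙ _)

end Geometric

section Elements

variable {C : Type u} [Category.{v} C]

/-- The category of elements `∫ P` of a presheaf `P`: objects are pairs `(X, x)` with `x ∈ P(X)`,
morphisms `(Y, y) ⟶ (X, x)` are the arrows `g : Y ⟶ X` with `P(g)(x) = y`.
(Mathlib's `P.Elements` for a functor on `Cᵒᵖ` is the opposite of this category.) -/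
abbrev Elts (P : Cᵒᵖ ⥤ Type w) : Type (max u w) := P.Elementsᵒᵖ

/-- The object `(X, x)` of `∫ P`. -/
abbrev Elts.mk (P : Cᵒᵖ ⥤ Type w) (X : C) (x : P.obj (op X)) : Elts P :=
  op (P.elementsMk (op X) x)

/-- The morphism `(Y, y) ⟶ (X, x)` of `∫ P` given by `g : Y ⟶ X` with `P(g)(x) = y`. -/
abbrev Elts.homMk {P : Cᵒᵖ ⥤ Type w} {X Y : C} {x : P.obj (op X)} {y : P.obj (op Y)}
    (g : Y ⟶ X) (h : P.map g.op x = y) : Elts.mk P Y y ⟶ Elts.mk P X x :=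
  Quiver.Hom.op (CategoryOfElements.homMk (P.elementsMk (op X) x) (P.elementsMk (op Y) y) g.op h)

/-- The canonical functor `π_P : ∫ P ⥤ C`. -/
abbrev eltsπ (P : Cᵒᵖ ⥤ Type w) : Elts P ⥤ C := (CategoryOfElements.π P).leftOp

/-- The functor `∫ f : ∫ P ⥤ ∫ Q`, `(X, p) ↦ (X, f_X(p))`, induced by `f : P ⟶ Q`. -/
abbrev eltsMap {P Q : Cᵒᵖ ⥤ Type w} (f : P ⟶ Q) : Elts P ⥤ Elts Q :=
  (CategoryOfElements.map f).op

lemma sieve_homMk_iff {P : Cᵒᵖ ⥤ Type w} {X Y : C} {x : P.obj (op X)} {y y' : P.obj (op Y)}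
    (S : Sieve (Elts.mk P X x)) (g : Y ⟶ X) (h : P.map g.op x = y) (h' : P.map g.op x = y') :
    S (Elts.homMk g h) ↔ S (Elts.homMk g h') := by
  subst h
  subst h'
  exact Iff.rfl

lemma functorPushforward_π_iff (P : Cᵒᵖ ⥤ Type w) {X : C} {x : P.obj (op X)}
    (S : Sieve (Elts.mk P X x)) {Y : C} (g : Y ⟶ X) :
    (S.functorPushforward (eltsπ P)) g ↔ S (Elts.homMk (x := x) g rfl) := by
  constructor
  · rintro ⟨⟨⟨⟨Z⟩, z⟩⟩, ⟨k, hk⟩, m, hS, hm⟩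
    obtain ⟨k, rfl⟩ : ∃ k' : Z ⟶ X, k = k'.op := ⟨k.unop, rfl⟩
    change Y ⟶ Z at m
    replace hm : g = m ≫ k := hm
    replace hk : P.map k.op x = z := hk
    subst hk
    subst hm
    have hz : P.map (m ≫ k).op x = P.map m.op (P.map k.op x) := by
      rw [op_comp, Functor.map_comp_apply]
    rw [sieve_homMk_iff S _ rfl hz]
    exact S.downward_closed hS (Elts.homMk (x := P.map k.op x) m rfl)
  · intro h
    exact ⟨_, Elts.homMk (x := x) g rfl, 𝟙 _, h, (Category.id_comp g).symm⟩

/-- The Grothendieck topology `J_P` on `∫ P`: its covering sieves are precisely those sent to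
`J`-covering sieves by `π_P : ∫ P ⥤ C`. -/
def eltsTopology (J : GrothendieckTopology C) (P : Cᵒᵖ ⥤ Type w) :
    GrothendieckTopology (Elts P) where
  sieves E := {S | S.functorPushforward (eltsπ P) ∈ J ((eltsπ P).obj E)}
  top_mem' E := by
    have h : (⊤ : Sieve E).functorPushforward (eltsπ P) ∈ J ((eltsπ P).obj E) := by
      rw [Sieve.functorPushforward_top]
      exact J.top_mem _
    exact h
  pullback_stable' := by
    rintro ⟨⟨⟨X⟩, x⟩⟩ ⟨⟨⟨Y⟩, y⟩⟩ S ⟨k, hk⟩ hS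
    obtain ⟨k, rfl⟩ : ∃ k' : Y ⟶ X, k = k'.op := ⟨k.unop, rfl⟩
    replace hk : P.map k.op x = y := hk
    subst hk
    refine J.superset_covering ?_ (J.pullback_stable k hS)
    intro Z g hg
    change Z ⟶ Y at g
    refine (functorPushforward_π_iff P _ g).2 ?_
    have hz : P.map (g ≫ k).op x = P.map g.op (P.map k.op x) :=
      Functor.map_comp_apply P k.op g.op x
    exact (sieve_homMk_iff S _ rfl hz).1 ((functorPushforward_π_iff P S (g ≫ k)).1 hg)
  transitive' := by
    rintro ⟨⟨⟨X⟩, x⟩⟩ S hS R hR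
    refine J.transitive hS _ ?_
    intro Y g hg
    have hg' := (functorPushforward_π_iff P S g).1 hg
    refine J.superset_covering ?_ (hR hg')
    intro Z m hm
    have hm' := (functorPushforward_π_iff P (R.pullback (Elts.homMk (x := x) g rfl)) m).1 hm
    exact ⟨_, Elts.homMk (x := P.map g.op x) m rfl ≫ Elts.homMk (x := x) g rfl, 𝟙 _, hm',
      (Category.id_comp (m ≫ g)).symm⟩

lemma mem_eltsTopology_iff (J : GrothendieckTopology C) (P : Cᵒᵖ ⥤ Type w) {E : Elts P}
    (S : Sieve E) : S ∈ eltsTopology J P E ↔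
      S.functorPushforward (eltsπ P) ∈ J ((eltsπ P).obj E) := Iff.rfl

/-- `∫ f` is a comorphism of sites `(∫ P, J_P) → (∫ Q, J_Q)`. -/
instance eltsMap_isCocontinuous (J : GrothendieckTopology C) {P Q : Cᵒᵖ ⥤ Type w} (f : P ⟶ Q) :
    (eltsMap f).IsCocontinuous (eltsTopology J P) (eltsTopology J Q) where
  cover_lift := by
    rintro ⟨⟨⟨X⟩, x⟩⟩ S hS
    refine J.superset_covering ?_ hS
    intro Y g hg
    refine (functorPushforward_π_iff P _ g).2 ?_
    have hz : Q.map g.op (f.app (op X) x) = f.app (op Y) (P.map g.op x) :=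
      (NatTrans.naturality_apply f g.op x).symm
    exact (sieve_homMk_iff (x := f.app (op X) x) S g rfl hz).1
      ((functorPushforward_π_iff Q (x := f.app (op X) x) S g).1 hg)

/-- The functor `R_P : [Cᵒᵖ, Set]/P ⥤ [(∫ P)ᵒᵖ, Set]`, `R_P[h](X, p) = h_X⁻¹(p)`. -/
def R (P : Cᵒᵖ ⥤ Type w) : Over P ⥤ ((Elts P)ᵒᵖ ⥤ Type w) where
  obj h :=
    { obj := fun E => {y : h.left.obj E.unop.unop.1 // h.hom.app E.unop.unop.1 y = E.unop.unop.2}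
      map := fun {E E'} g => ↾fun y => ⟨h.left.map g.unop.unop.val y.1, by
        have h₁ := NatTrans.naturality_apply h.hom g.unop.unop.val y.1
        rw [y.2] at h₁
        exact h₁.trans g.unop.unop.2⟩
      map_id := fun E => ConcreteCategory.hom_ext _ _ fun y => Subtype.ext
        (ConcreteCategory.congr_hom (h.left.map_id E.unop.unop.1) y.1)
      map_comp := fun g g' => ConcreteCategory.hom_ext _ _ fun y => Subtype.ext
        (Functor.map_comp_apply h.left g.unop.unop.val g'.unop.unop.val y.1) }
  map {h h'} k :=
    { app := fun E => ↾fun y => ⟨k.left.app E.unop.unop.1 y.1, by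
        have h₁ := ConcreteCategory.congr_hom (NatTrans.congr_app (Over.w k) E.unop.unop.1) y.1
        exact h₁.trans y.2⟩
      naturality := fun E E' g => ConcreteCategory.hom_ext _ _ fun y => Subtype.ext
        (NatTrans.naturality_apply k.left g.unop.unop.val y.1) }
  map_id := fun h => rfl
  map_comp := fun k k' => rfl

lemma isSheaf_R_of_isPullback (J : GrothendieckTopology C) (P : Cᵒᵖ ⥤ Type w) (h : Over P)
    {W A : Cᵒᵖ ⥤ Type w} (hW : Presieve.IsSheaf J W) (hA : Presieve.IsSheaf J A)
    {fst : h.left ⟶ W} {k : W ⟶ A} {η : P ⟶ A} (sq : IsPullback fst h.hom k η) :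
    Presieve.IsSheaf (eltsTopology J P) ((R P).obj h) := by
  have comm : ∀ (X : C) (z : h.left.obj (op X)),
      k.app (op X) (fst.app (op X) z) = η.app (op X) (h.hom.app (op X) z) := fun X z =>
    ConcreteCategory.congr_hom (NatTrans.congr_app sq.w (op X)) z
  have sqX : ∀ X : C, IsPullback (fst.app (op X)) (h.hom.app (op X)) (k.app (op X))
      (η.app (op X)) := fun X => sq.map ((evaluation Cᵒᵖ (Type w)).obj (op X))
  have inj : ∀ (X : C) (z z' : h.left.obj (op X)), fst.app (op X) z = fst.app (op X) z' →
      h.hom.app (op X) z = h.hom.app (op X) z' → z = z' := fun X z z' h₁ h₂ =>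
    Types.ext_of_isPullback (sqX X) h₁ h₂
  have ex : ∀ (X : C) (a : W.obj (op X)) (p : P.obj (op X)), k.app (op X) a = η.app (op X) p →
      ∃ z, fst.app (op X) z = a ∧ h.hom.app (op X) z = p := fun X a p e =>
    Types.exists_of_isPullback (sqX X) a p e
  rintro ⟨⟨⟨X⟩, p⟩⟩ S hS x hx
  replace hS : S.functorPushforward (eltsπ P) ∈ J X := hS
  have mem : ∀ {Y : C} {g : Y ⟶ X}, S.functorPushforward (eltsπ P) g →
      S (Elts.homMk (x := p) g rfl) := fun hg => (functorPushforward_π_iff P S _).1 hg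
  have val : ∀ {Y : C} {g : Y ⟶ X} {q : P.obj (op Y)} (hq : P.map g.op p = q)
      (hg : S (Elts.homMk (x := p) g hq)) (hg' : S (Elts.homMk (x := p) g rfl)),
      (x (Elts.homMk (x := p) g hq) hg).1 = (x (Elts.homMk (x := p) g rfl) hg').1 := by
    intro Y g q hq hg hg'
    subst hq
    rfl
  let y : Presieve.FamilyOfElements W (S.functorPushforward (eltsπ P)).arrows :=
    fun Y g hg => fst.app (op Y) (x (Elts.homMk (x := p) g rfl) (mem hg)).1
  have hy : y.Compatible := by
    rw [Presieve.compatible_iff_sieveCompatible]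
    intro Y Z g m hg
    have hz : P.map (m ≫ g).op p = P.map m.op (P.map g.op p) :=
      Functor.map_comp_apply P g.op m.op p
    have h₁ := (Presieve.compatible_iff_sieveCompatible x).1 hx
      (Elts.homMk (x := p) g rfl) (Elts.homMk (x := P.map g.op p) m rfl) (mem hg)
    have h₂ := congrArg Subtype.val h₁
    have h₃ := val hz (S.downward_closed (mem hg) (Elts.homMk (x := P.map g.op p) m rfl))
      (mem (Sieve.downward_closed _ hg m))
    have h₄ := congrArg (fst.app (op Z)) (h₃.symm.trans h₂)
    exact h₄.trans (NatTrans.naturality_apply fst m.op _)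
  obtain ⟨t, ht, htu⟩ := hW _ hS y hy
  have hkt : k.app (op X) t = η.app (op X) p := by
    refine (hA _ hS).isSeparatedFor.ext fun Y g hg => ?_
    have h₁ : W.map g.op t = fst.app (op Y) (x (Elts.homMk (x := p) g rfl) (mem hg)).1 := ht g hg
    have h₂ : h.hom.app (op Y) (x (Elts.homMk (x := p) g rfl) (mem hg)).1 = P.map g.op p :=
      (x (Elts.homMk (x := p) g rfl) (mem hg)).2
    rw [← NatTrans.naturality_apply k, ← NatTrans.naturality_apply η, h₁, comm, h₂]
  obtain ⟨z, hz₁, hz₂⟩ := ex X t p hkt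
  refine ⟨⟨z, hz₂⟩, ?_, ?_⟩
  · rintro ⟨⟨⟨Y⟩, q⟩⟩ ⟨g, hq⟩ hg
    obtain ⟨g, rfl⟩ : ∃ g' : Y ⟶ X, g = g'.op := ⟨g.unop, rfl⟩
    replace hq : P.map g.op p = q := hq
    subst hq
    have hg' : S.functorPushforward (eltsπ P) g := (functorPushforward_π_iff P S g).2 hg
    apply Subtype.ext
    refine inj Y _ _ ?_ ?_
    · have h₁ : W.map g.op t = fst.app (op Y) (x (Elts.homMk (x := p) g rfl) hg).1 := ht g hg'
      exact ((NatTrans.naturality_apply fst g.op z).trans (congrArg (W.map g.op) hz₁)).trans h₁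
    · refine Eq.trans ?_ (x (Elts.homMk (x := p) g rfl) hg).2.symm
      exact (NatTrans.naturality_apply h.hom g.op z).trans (congrArg (P.map g.op) hz₂)
  · rintro ⟨z', hz'⟩ hz'a
    apply Subtype.ext
    refine inj X _ _ ?_ (Eq.trans hz' hz₂.symm)
    rw [hz₁]
    refine htu _ fun Y g hg => ?_
    have h₁ := congrArg Subtype.val (hz'a (Elts.homMk (x := p) g rfl) (mem hg))
    have h₂ := congrArg (fst.app (op Y)) h₁
    exact (NatTrans.naturality_apply fst g.op z').symm.trans h₂

lemma map_map_eq {D : Type u₁} [Category.{v₁} D] (W : D ⥤ Type w) {E E₁ E₂ E' : D}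
    (a : E ⟶ E₁) (b : E₁ ⟶ E') (a' : E ⟶ E₂) (b' : E₂ ⟶ E') (h : a ≫ b = a' ≫ b')
    (z : W.obj E) : W.map b (W.map a z) = W.map b' (W.map a' z) := by
  rw [← Functor.map_comp_apply, h, Functor.map_comp_apply]

lemma sigma_ext_elts {P : Cᵒᵖ ⥤ Type w} (W : (Elts P)ᵒᵖ ⥤ Type w) {X : Cᵒᵖ} {p q : P.obj X}
    (h : p = q) (a : W.obj (op (op (P.elementsMk X p)))) (b : W.obj (op (op (P.elementsMk X q))))
    (hab : W.map (Quiver.Hom.op (Quiver.Hom.op (CategoryOfElements.homMk (P.elementsMk X p)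
      (P.elementsMk X q) (𝟙 X) (by simpa using h)))) a = b) :
    (⟨p, a⟩ : Σ p : P.obj X, W.obj (op (op (P.elementsMk X p)))) = ⟨q, b⟩ := by
  subst h
  subst hab
  congr 1
  exact (ConcreteCategory.congr_hom (W.map_id (op (op (P.elementsMk X p)))) a).symm

/-- The functor `L_P : [(∫ P)ᵒᵖ, Set] ⥤ [Cᵒᵖ, Set]/P`, `L_P(W)(X) = ⨆_{p ∈ P(X)} W(X, p)`, with
structural morphism sending the component `W(X, p)` to `p`. -/
def L (P : Cᵒᵖ ⥤ Type w) : ((Elts P)ᵒᵖ ⥤ Type w) ⥤ Over P where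
  obj W := Over.mk (Y :=
    { obj := fun X => Σ p : P.obj X, W.obj (op (op (P.elementsMk X p)))
      map := fun {X Y} g => ↾fun z => ⟨P.map g z.1, W.map
        (Quiver.Hom.op (Quiver.Hom.op (CategoryOfElements.homMk (P.elementsMk X z.1)
          (P.elementsMk Y (P.map g z.1)) g rfl))) z.2⟩
      map_id := fun X => by
        refine ConcreteCategory.hom_ext _ _ fun ⟨p, a⟩ => ?_
        refine sigma_ext_elts W (ConcreteCategory.congr_hom (P.map_id X) p) _ _ ?_
        rw [← Functor.map_comp_apply]
        refine (ConcreteCategory.congr_hom (congrArg W.map ?_) a).trans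
          (ConcreteCategory.congr_hom (W.map_id _) a)
        apply Quiver.Hom.unop_inj
        apply Quiver.Hom.unop_inj
        apply CategoryOfElements.ext
        exact Category.comp_id (𝟙 X)
      map_comp := fun {X Y Z} g g' => by
        refine ConcreteCategory.hom_ext _ _ fun ⟨p, a⟩ => ?_
        refine sigma_ext_elts W (P.map_comp_apply g g' p) _ _ ?_
        refine map_map_eq W _ _ _ _ ?_ a
        apply Quiver.Hom.unop_inj
        apply Quiver.Hom.unop_inj
        apply CategoryOfElements.ext
        exact Category.comp_id (g ≫ g') })
    { app := fun X => ↾fun z => z.1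
      naturality := fun X Y g => by ext z; rfl }
  map {W W'} k := Over.homMk
    { app := fun X => ↾fun z => ⟨z.1, k.app _ z.2⟩
      naturality := fun X Y g => ConcreteCategory.hom_ext _ _ fun ⟨p, a⟩ =>
        congrArg (Sigma.mk _) (NatTrans.naturality_apply k _ a) } (by ext X z; rfl)
  map_id := fun W => by
    apply Over.OverMorphism.ext
    ext X z
    rfl
  map_comp := fun k k' => by
    apply Over.OverMorphism.ext
    ext X z
    rfl

variable [EssentiallySmall.{w} C] (J : GrothendieckTopology C)

/-- The associated sheaf `a(P)`. -/
abbrev shf (P : Cᵒᵖ ⥤ Type w) : Sheaf J (Type w) := (presheafToSheaf J (Type w)).obj P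

/-- The morphism `a(f) : a(P) ⟶ a(Q)`. -/
abbrev shfMap {P Q : Cᵒᵖ ⥤ Type w} (f : P ⟶ Q) : shf J P ⟶ shf J Q :=
  (presheafToSheaf J (Type w)).map f

/-- The inclusion `i_P : Sh(C, J)/a(P) ⥤ [Cᵒᵖ, Set]/P`, sending `w : W ⟶ a(P)` to the pullback of
(the underlying morphism of presheaves of) `w` along the unit `η_P : P ⟶ a(P)`. -/
def sliceIncl (P : Cᵒᵖ ⥤ Type w) : Over (shf J P) ⥤ Over P :=
  Over.post (sheafToPresheaf J (Type w)) ⋙ Over.pullback (toSheafify J P)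

/-- The functor `a_P : [Cᵒᵖ, Set]/P ⥤ Sh(C, J)/a(P)`, `[h] ↦ [a(h)]`. -/
def sliceSheafify (P : Cᵒᵖ ⥤ Type w) : Over P ⥤ Over (shf J P) :=
  Over.post (presheafToSheaf J (Type w))

lemma isSheaf_R_sliceIncl (P : Cᵒᵖ ⥤ Type w) (W : Over (shf J P)) :
    Presheaf.IsSheaf (eltsTopology J P) ((R P).obj ((sliceIncl J P).obj W)) := by
  rw [isSheaf_iff_isSheaf_of_type]
  exact isSheaf_R_of_isPullback J P _
    ((isSheaf_iff_isSheaf_of_type J _).1 W.left.property)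
    ((isSheaf_iff_isSheaf_of_type J _).1 (shf J P).property)
    (IsPullback.of_hasPullback ((sheafToPresheaf J (Type w)).map W.hom) (toSheafify J P))

/-- The functor `R_P^J : Sh(C, J)/a(P) ⥤ Sh(∫ P, J_P)`, acting as `R_P ∘ i_P`. -/
def RJ (P : Cᵒᵖ ⥤ Type w) : Over (shf J P) ⥤ Sheaf (eltsTopology J P) (Type w) :=
  ObjectProperty.lift _ (sliceIncl J P ⋙ R P) (isSheaf_R_sliceIncl J P)

/-- The functor `L_P^J = a_P ∘ L_P ∘ i_{J_P} : Sh(∫ P, J_P) ⥤ Sh(C, J)/a(P)`. -/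
def LJ (P : Cᵒᵖ ⥤ Type w) : Sheaf (eltsTopology J P) (Type w) ⥤ Over (shf J P) :=
  sheafToPresheaf (eltsTopology J P) (Type w) ⋙ L P ⋙ sliceSheafify J P

end Elements

end DepProd

end

noncomputable section

namespace DepProd

/-! ### Presheaves over `P` versus presheaves on `∫ P` -/

section Presheaves

variable {C : Type u} [Category.{v} C]

/-! The functor `R_P` is fully faithful because a presheaf over `P` is the disjoint union of its
fibres. The functor `i_P` is fully faithful because associated sheaves preserve pullbacks and invert
`η_P`. So the composite adjunction `L_P^J ⊣ R_P^J` has a fully faithful right adjoint. Moreover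
`L_P^J` reflects isomorphisms: covering sieves in `J_P` are tested in `C`, so local bijectivity of
`L_P(k)` is that of `k`, and a locally bijective map of sheaves is invertible. The triangle identity
then makes the unit invertible, which gives the equivalence.

For the dependent product it suffices to compare left adjoints. On presheaves, the fibre of a
pullback along `f` over `p` is the fibre over `f(p)`, so pulling back along `f` is restricting along
`∫ f`. After sheafifying, `a(f)^*` corresponds to the inverse image of `C(∫ f)`, and uniqueness of
right adjoints does the rest. -/

/-- The functor `L_P` is left adjoint to `R_P`. -/
def adjLR (P : Cᵒᵖ ⥤ Type w) : L P ⊣ R P where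
  unit :=
    { app := fun W =>
        { app := fun E => ↾fun a => ⟨⟨E.unop.unop.2, a⟩, rfl⟩
          naturality := fun E E' g => by
            refine ConcreteCategory.hom_ext _ _ fun a => Subtype.ext ?_
            -- The two indices, `P(g)(x)` and the second component of `E'`, are only propositionally
            -- equal, so the fibres are compared along an identity arrow of `C`.
            refine (sigma_ext_elts W g.unop.unop.2 _ _ ?_).symm
            refine (Functor.map_comp_apply W _ _ a).symm.trans ?_
            refine ConcreteCategory.congr_hom (congrArg W.map ?_) a
            apply Quiver.Hom.unop_inj
            apply Quiver.Hom.unop_inj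
            apply CategoryOfElements.ext
            exact Category.comp_id g.unop.unop.val }
      naturality := fun W W' k => rfl }
  counit :=
    { app := fun h => Over.homMk
        { app := fun X => ↾fun z => z.2.1
          naturality := fun X Y g => rfl } (by
            ext X z
            exact z.2.2)
      naturality := fun h h' k => rfl }
  left_triangle_components := fun W => rfl
  right_triangle_components := fun h => rfl

/-- Each element of the total presheaf lies in exactly one fibre. -/
instance isIso_counit_adjLR (P : Cᵒᵖ ⥤ Type w) : IsIso (adjLR P).counit := by
  rw [NatTrans.isIso_iff_isIso_app]
  intro h
  rw [← isIso_iff_of_reflects_iso _ (Over.forget P), NatTrans.isIso_iff_isIso_app]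
  intro X
  rw [isIso_iff_bijective]
  constructor
  · rintro ⟨p, y, hy⟩ ⟨p', y', hy'⟩ (e : y = y')
    subst e
    -- Both indices equal the image of `y`; making them variables allows them to be substituted.
    have aux : ∀ (q q' : P.obj X) (hq : h.hom.app X y = q) (hq' : h.hom.app X y = q'),
        (⟨q, y, hq⟩ : Σ q : P.obj X, {y : h.left.obj X // h.hom.app X y = q}) = ⟨q', y, hq'⟩ := by
      rintro _ _ rfl rfl
      rfl
    exact aux p p' hy hy'
  · intro y
    exact ⟨⟨h.hom.app X y, y, rfl⟩, rfl⟩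

/-- Two sections over `(X, p)` become elements of `L_P(W)(X)` with the same index `p`. Their
restrictions again share an index, so they agree in the sum exactly when they agree in `W`. -/
lemma isLocallyInjective_of_L_map (J : GrothendieckTopology C) {P : Cᵒᵖ ⥤ Type w}
    {W W' : (Elts P)ᵒᵖ ⥤ Type w} (k : W ⟶ W')
    (hk : Presheaf.IsLocallyInjective J ((L P).map k).left) :
    Presheaf.IsLocallyInjective (eltsTopology J P) k where
  equalizerSieve_mem := by
    rintro ⟨⟨⟨⟨X⟩, p⟩⟩⟩ a b hab
    have h := hk.equalizerSieve_mem (X := op X) ⟨p, a⟩ ⟨p, b⟩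
      (congrArg (Sigma.mk (β := fun p : P.obj (op X) => W'.obj (op (op (P.elementsMk (op X) p)))) p)
        hab)
    refine J.superset_covering ?_ h
    intro Y g hg
    refine (functorPushforward_π_iff P (x := p) _ g).2 ?_
    exact eq_of_heq (Sigma.mk.inj hg).2

lemma isLocallySurjective_of_L_map (J : GrothendieckTopology C) {P : Cᵒᵖ ⥤ Type w}
    {W W' : (Elts P)ᵒᵖ ⥤ Type w} (k : W ⟶ W')
    (hk : Presheaf.IsLocallySurjective J ((L P).map k).left) :
    Presheaf.IsLocallySurjective (eltsTopology J P) k where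
  imageSieve_mem := by
    rintro ⟨⟨⟨X⟩, p⟩⟩ b
    have h := hk.imageSieve_mem (U := X) ⟨p, b⟩
    refine J.superset_covering ?_ h
    rintro Y g ⟨⟨q, a⟩, ha⟩
    refine (functorPushforward_π_iff P (x := p) _ g).2 ?_
    -- `L_P(k)` preserves indices, so a local preimage automatically lies in the right fibre.
    obtain rfl : q = P.map g.op p := congrArg Sigma.fst ha
    exact ⟨a, eq_of_heq (Sigma.mk.inj ha).2⟩

/-- The fibre functors intertwine pullback along `f` with restriction along `∫ f`. -/
def pullbackCompR {P Q : Cᵒᵖ ⥤ Type w} (f : P ⟶ Q) :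
    Over.pullback f ⋙ R P ≅
      R Q ⋙ (Functor.whiskeringLeft _ _ (Type w)).obj (eltsMap f).op :=
  have comm (h : Over Q) (X : Cᵒᵖ) (z : (pullback h.hom f).obj X) :
      h.hom.app X ((pullback.fst h.hom f).app X z) = f.app X ((pullback.snd h.hom f).app X z) :=
    ConcreteCategory.congr_hom (NatTrans.congr_app (pullback.condition (f := h.hom) (g := f)) X) z
  let α : Over.pullback f ⋙ R P ⟶
      R Q ⋙ (Functor.whiskeringLeft _ _ (Type w)).obj (eltsMap f).op :=
    { app := fun h =>
        { app := fun E => ↾fun z =>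
            ⟨(pullback.fst h.hom f).app E.unop.unop.1 z.1,
              (comm h _ z.1).trans (congrArg (f.app E.unop.unop.1) z.2)⟩
          naturality := fun E E' g => ConcreteCategory.hom_ext _ _ fun z => Subtype.ext
            (NatTrans.naturality_apply (pullback.fst h.hom f) g.unop.unop.val z.1) }
      naturality := fun h h' k => by
        ext E z
        apply Subtype.ext
        have e : ((Over.pullback f).map k).left ≫ pullback.fst h'.hom f =
            pullback.fst h.hom f ≫ k.left := pullback.lift_fst _ _ _
        exact ConcreteCategory.congr_hom (NatTrans.congr_app e E.unop.unop.1) z.1 }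
  have : IsIso α := by
    rw [NatTrans.isIso_iff_isIso_app]
    intro h
    rw [NatTrans.isIso_iff_isIso_app]
    intro E
    rw [isIso_iff_bijective]
    -- Evaluation preserves pullbacks, so the fibre over `p` consists of pairs `(y, p)` with `h(y) =
    -- f(p)`.
    have sq := (IsPullback.of_hasPullback h.hom f).map
      ((evaluation Cᵒᵖ (Type w)).obj E.unop.unop.1)
    constructor
    · intro z z' e
      exact Subtype.ext (Types.ext_of_isPullback sq (congrArg Subtype.val e) (z.2.trans z'.2.symm))
    · rintro ⟨y, hy⟩
      obtain ⟨z, h₁, h₂⟩ := Types.exists_of_isPullback sq y E.unop.unop.2 hy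
      exact ⟨⟨z, h₂⟩, Subtype.ext h₁⟩
  asIso α

end Presheaves

/-! ### Passage to sheaves, the equivalence and the dependent product -/

section Sheaves

variable {C : Type u} [Category.{v} C] [EssentiallySmall.{w} C] (J : GrothendieckTopology C)

instance wEqualsLocallyBijective_type : J.WEqualsLocallyBijective (Type w) :=
  have (K : GrothendieckTopology (SmallModel.{w} C)) : K.WEqualsLocallyBijective (Type w) :=
    inferInstance
  GrothendieckTopology.WEqualsLocallyBijective.ofEssentiallySmall J

/-- The functor `a_P` is left adjoint to `i_P`. -/
def sliceAdj (P : Cᵒᵖ ⥤ Type w) : sliceSheafify J P ⊣ sliceIncl J P :=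
  Over.postAdjunctionLeft (sheafificationAdjunction J (Type w))

/-- The counit is `a` of the projection `i_P(W) → W`, followed by the counit of sheafification. That
projection is a pullback of `η_P`, and `a` preserves pullbacks and inverts `η_P`. -/
instance isIso_counit_sliceAdj (P : Cᵒᵖ ⥤ Type w) : IsIso (sliceAdj J P).counit := by
  rw [NatTrans.isIso_iff_isIso_app]
  intro W
  rw [← isIso_iff_of_reflects_iso _ (Over.forget (shf J P))]
  have sq := (IsPullback.of_hasPullback ((sheafToPresheaf J (Type w)).map W.hom)
    (toSheafify J P)).map (presheafToSheaf J (Type w))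
  have : IsIso ((presheafToSheaf J (Type w)).map (toSheafify J P)) :=
    (J.W_iff _).1 (J.W_toSheafify P)
  have := sq.isIso_fst_of_isIso
  have e : (Over.forget (shf J P)).map ((sliceAdj J P).counit.app W) =
      (presheafToSheaf J (Type w)).map
        (pullback.fst ((sheafToPresheaf J (Type w)).map W.hom) (toSheafify J P)) ≫
      (sheafificationAdjunction J (Type w)).counit.app W.left :=
    Over.postAdjunctionLeft_counit_app_left _ _
  rw [e]
  have : IsIso ((sheafificationAdjunction J (Type w)).counit.app W.left) := inferInstance
  exact IsIso.comp_isIso' ‹_› this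

/-- The functor `L_P^J` is left adjoint to `R_P^J`. -/
def adjLJRJ (P : Cᵒᵖ ⥤ Type w) : LJ J P ⊣ RJ J P :=
  ((adjLR P).comp (sliceAdj J P)).restrictFullyFaithful
    (fullyFaithfulSheafToPresheaf (eltsTopology J P) (Type w)) (Functor.FullyFaithful.id _)
    (Iso.refl _) (Iso.refl _)

/-- The functor `R_P^J` is fully faithful. -/
def fullyFaithfulRJ (P : Cᵒᵖ ⥤ Type w) : (RJ J P).FullyFaithful :=
  Functor.FullyFaithful.ofCompFaithful (G := sheafToPresheaf (eltsTopology J P) (Type w))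
    ((sliceAdj J P).fullyFaithfulROfIsIsoCounit.comp (adjLR P).fullyFaithfulROfIsIsoCounit)

/-- This replaces a direct proof that the unit of `L_P^J ⊣ R_P^J` is invertible. -/
instance reflectsIsomorphisms_LJ (P : Cᵒᵖ ⥤ Type w) : (LJ J P).ReflectsIsomorphisms where
  reflects {W W'} k _ := by
    have h : IsIso ((presheafToSheaf J (Type w)).map ((L P).map k.hom).left) :=
      inferInstanceAs (IsIso ((Over.forget _).map ((LJ J P).map k)))
    -- A map of presheaves is inverted by sheafification exactly when it is locally bijective.
    rw [← J.W_iff, J.W_iff_isLocallyBijective] at h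
    exact Sheaf.isLocallyBijective_iff_isIso k |>.1
      ⟨isLocallyInjective_of_L_map J k.hom h.1, isLocallySurjective_of_L_map J k.hom h.2⟩

/-- The functors `R_P^J` and `L_P^J` form an equivalence of categories. -/
def equivRJ (P : Cᵒᵖ ⥤ Type w) : Over (shf J P) ≌ Sheaf (eltsTopology J P) (Type w) :=
  have := (fullyFaithfulRJ J P).full
  have := (fullyFaithfulRJ J P).faithful
  have (W : Sheaf (eltsTopology J P) (Type w)) : IsIso ((adjLJRJ J P).unit.app W) := by
    have : IsIso ((LJ J P).map ((adjLJRJ J P).unit.app W)) :=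
      -- The counit is invertible since `R_P^J` is fully faithful, so its one-sided inverse is too.
      isIso_of_comp_hom_eq_id _ ((adjLJRJ J P).left_triangle_components W)
    exact isIso_of_reflects_iso _ (LJ J P)
  (adjLJRJ J P).toEquivalence.symm

variable {P Q : Cᵒᵖ ⥤ Type w} (f : P ⟶ Q)

/-- Pulling back along `a(f)` and then along `η_P` is the same as pulling back along `η_Q` and then
along `f`. -/
def pullbackCompSliceIncl :
    Over.pullback (shfMap J f) ⋙ sliceIncl J P ≅ sliceIncl J Q ⋙ Over.pullback f :=
  -- Both sides are right adjoints; their left adjoints send `h` to `a(h) ≫ a(f)` and `a(h ≫ f)`,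
  -- which agree by functoriality.
  conjugateIsoEquiv ((sliceAdj J P).comp (Over.mapPullbackAdj (shfMap J f)))
    ((Over.mapPullbackAdj f).comp (sliceAdj J Q))
    (NatIso.ofComponents fun h => Over.isoMk (Iso.refl _)
      ((Category.id_comp _).trans ((presheafToSheaf J (Type w)).map_comp h.hom f).symm))

/-- The equivalences `R^J` intertwine pullback along `a(f)` with the inverse image of `C(∫ f)`. -/
def pullbackCompRJ :
    Over.pullback (shfMap J f) ⋙ RJ J P ≅ RJ J Q ⋙ (comorphismGeometric (eltsTopology J P)
      (eltsTopology J Q) (eltsMap f)).inverse :=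
  let β : (Over.pullback (shfMap J f) ⋙ RJ J P) ⋙ sheafToPresheaf (eltsTopology J P) (Type w) ≅
      RJ J Q ⋙ sheafToPresheaf (eltsTopology J Q) (Type w) ⋙
        (Functor.whiskeringLeft _ _ (Type w)).obj (eltsMap f).op :=
    Functor.isoWhiskerRight (pullbackCompSliceIncl J f) (R P) ≪≫
      Functor.isoWhiskerLeft (sliceIncl J Q) (pullbackCompR f)
  -- A sheaf is the associated sheaf of its underlying presheaf, so it suffices to sheafify the
  -- presheaf-level isomorphism `β`.
  (Functor.isoWhiskerLeft (Over.pullback (shfMap J f) ⋙ RJ J P)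
    (asIso (sheafificationAdjunction (eltsTopology J P) (Type w)).counit)).symm ≪≫
    Functor.isoWhiskerRight β (presheafToSheaf (eltsTopology J P) (Type w))

/-- Pullback along `a(f)` is left adjoint to the direct image of `C(∫ f)`, transported along the
equivalences `R^J` and `L^J`. -/
def pullbackAdj : Over.pullback (shfMap J f) ⊣
    RJ J P ⋙ (comorphismGeometric (eltsTopology J P) (eltsTopology J Q) (eltsMap f)).direct ⋙
      LJ J Q :=
  -- The composite left adjoint is `R_Q^J`, then the inverse image, then `L_P^J`; it is identified
  -- with `a(f)^*` by cancelling `R_P^J` against `L_P^J`.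
  (((equivRJ J Q).toAdjunction.comp (comorphismGeometric (eltsTopology J P) (eltsTopology J Q)
    (eltsMap f)).adj).comp (equivRJ J P).symm.toAdjunction).ofNatIsoLeft
    (Functor.isoWhiskerRight (pullbackCompRJ J f).symm (LJ J P) ≪≫
      Functor.isoWhiskerLeft (Over.pullback (shfMap J f)) (equivRJ J P).unitIso.symm)

end Sheaves

end DepProd

end

open DepProd in
theorem mainTheorem2 {C : Type u} [Category.{v} C] [EssentiallySmall.{w} C]
    (J : GrothendieckTopology C) {P Q : Cᵒᵖ ⥤ Type w} (f : P ⟶ Q) :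
    (∃ e : Over (shf J P) ≌ Sheaf (eltsTopology J P) (Type w),
      e.functor = RJ J P ∧ e.inverse = LJ J P) ∧
    (∃ e : Over (shf J Q) ≌ Sheaf (eltsTopology J Q) (Type w),
      e.functor = RJ J Q ∧ e.inverse = LJ J Q) ∧
    (Over.pullback (shfMap J f)).IsLeftAdjoint ∧
    ∀ (Pi : Over (shf J P) ⥤ Over (shf J Q)) (_ : Over.pullback (shfMap J f) ⊣ Pi),
      Nonempty (RJ J P ⋙ (comorphismGeometric (eltsTopology J P) (eltsTopology J Q)
          (eltsMap f)).direct ≅ Pi ⋙ RJ J Q) ∧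
      Nonempty ((comorphismGeometric (eltsTopology J P) (eltsTopology J Q)
          (eltsMap f)).direct ⋙ LJ J Q ≅ LJ J P ⋙ Pi) := by
  refine ⟨⟨equivRJ J P, rfl, rfl⟩, ⟨equivRJ J Q, rfl, rfl⟩, (pullbackAdj J f).isLeftAdjoint, ?_⟩
  intro Pi adj
  let G := (comorphismGeometric (eltsTopology J P) (eltsTopology J Q) (eltsMap f)).direct
  let e : RJ J P ⋙ G ⋙ LJ J Q ≅ Pi := (pullbackAdj J f).rightAdjointUniq adj
  -- Each isomorphism comes from `e` by composing with one equivalence and cancelling it against its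
  -- inverse.
  exact ⟨⟨Functor.isoWhiskerLeft (RJ J P ⋙ G) (equivRJ J Q).counitIso.symm ≪≫
      Functor.isoWhiskerRight e (RJ J Q)⟩,
    ⟨Functor.isoWhiskerRight (equivRJ J P).counitIso.symm (G ⋙ LJ J Q) ≪≫
      Functor.isoWhiskerLeft (LJ J P) e⟩⟩
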